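/- Let $\mathcal A$ be a Desargues affine plane: an incidence structure of points and lines in which any two distinct points lie on exactly one line, through each point off a line there is exactly one line missing that line, there are three non-collinear points, and Desargues' axiom holds (if the lines $AA',BB',CC'$ are distinct and either parallel or concurrent, and $AB\parallel A'B'$, $BC\parallel B'C'$, then $AC\parallel A'C'$). Let $O\neq I$ be points and let $\ell^{OI}$ be the line through them. Points of $\ell^{OI}$ are added and multiplied as follows. Choose any point $B_1\notin\ell^{OI}$. - $X+Y$ is the intersection of $\ell^{OI}$ with the parallel to $YB_1$ through $P_1$, where $P_1$ is the intersection of the parallel to $\ell^{OI}$ through $B_1$ with the parallel to $OB_1$ through $X$. - $X\cdot Y$ is the intersection of $\ell^{OI}$ with the parallel to $YB_1$ through $P_1$, where $P_1$ is the intersection of the parallel to $IB_1$ through $X$ with the line $OB_1$. Neither result depends on $B_1$. Let $-X$ be the point with $X+(-X)=O$, let $X-Y=X+(-Y)$ and, for $X\ne O$, let $X^{-1}$ be the point with $X\cdot X^{-1}=I$. Let $B,C,D\in\ell^{OI}$ be three distinct fixed points, all different from $O$. For $X\in\ell^{OI}$, $X\neq D$, put $$\mu(X)=c_r(X,B;C,D)=\left[(X-D)^{-1}(B-D)\right]\left[(B-C)^{-1}(X-C)\right].$$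 Theorem. For all $X,Y,Z\in\ell^{OI}\setminus\{D\}$: 1. $[\mu(X)+\mu(Y)]+\mu(Z)=\mu(X)+[\mu(Y)+\mu(Z)]$; 2. $\mu(X)+\mu(Y)=\mu(Y)+\mu(X)$; 3. $\mu(C)=O$, and $\mu(X)+\mu(C)=\mu(C)+\mu(X)=\mu(X)$; that is, $\mu(C)=O$ is a zero element for the addition of Möbius points. -/

import Mathlib

section Plane

variable {P L : Type*} [Membership P L]

/-- Two lines are parallel if they coincide or have no common point. -/
def LineParallel (P : Type*) {L : Type*} [Membership P L] (l m : L) : Prop :=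
  l = m ∨ ∀ X : P, X ∈ l → X ∉ m

/-- Desargues affine planes: incidence structures with point set `P` and line set `L`
satisfying the axioms of an affine plane and the Desargues axiom. -/
class DesarguesAffinePlane (P L : Type*) [Membership P L] : Prop where
  /-- Two distinct points lie on exactly one line. -/
  existsUnique_line : ∀ X Y : P, X ≠ Y → ∃! l : L, X ∈ l ∧ Y ∈ l
  /-- Playfair: through a point off a line there is exactly one line missing that line. -/
  playfair : ∀ (X : P) (l : L), X ∉ l → ∃! m : L, X ∈ m ∧ ∀ Y : P, Y ∈ l → Y ∉ m
  /-- There are three non-collinear points. -/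
  exists_noncollinear : ∃ X Y Z : P, X ≠ Y ∧ Y ≠ Z ∧ X ≠ Z ∧
    ¬ ∃ l : L, X ∈ l ∧ Y ∈ l ∧ Z ∈ l
  /-- Desargues: if the distinct lines `a = AA'`, `b = BB'`, `c = CC'` are parallel or
  concurrent, `AB ∥ A'B'` and `BC ∥ B'C'`, then `AC ∥ A'C'`. -/
  desargues : ∀ (A B C A' B' C' : P) (a b c ab bc ac ab' bc' ac' : L),
    A ≠ A' → B ≠ B' → C ≠ C' → A ≠ B → B ≠ C → A ≠ C → A' ≠ B' → B' ≠ C' → A' ≠ C' →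
    A ∈ a → A' ∈ a → B ∈ b → B' ∈ b → C ∈ c → C' ∈ c →
    a ≠ b → b ≠ c → a ≠ c →
    ((LineParallel P a b ∧ LineParallel P b c) ∨ ∃ V : P, V ∈ a ∧ V ∈ b ∧ V ∈ c) →
    A ∈ ab → B ∈ ab → B ∈ bc → C ∈ bc → A ∈ ac → C ∈ ac →
    A' ∈ ab' → B' ∈ ab' → B' ∈ bc' → C' ∈ bc' → A' ∈ ac' → C' ∈ ac' →
    ab ≠ ab' → bc ≠ bc' →
    LineParallel P ab ab' → LineParallel P bc bc' → LineParallel P ac ac'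

namespace DesarguesAffinePlane

theorem parallel_refl (l : L) : LineParallel P l l := Or.inl rfl

theorem parallel_symm {l m : L} (h : LineParallel P l m) : LineParallel P m l := by
  rcases h with h | h
  · exact Or.inl h.symm
  · exact Or.inr fun X hm hl => h X hl hm

theorem parallel_eq {X : P} {l m : L} (h : LineParallel P l m) (hl : X ∈ l) (hm : X ∈ m) :
    l = m := by
  rcases h with h | h
  · exact h
  · exact absurd hm (h X hl)

theorem exists_meet {l m : L} (h : ¬ LineParallel P l m) : ∃ X : P, X ∈ l ∧ X ∈ m := by
  by_contra hc
  exact h (Or.inr fun X hl hm => hc ⟨X, hl, hm⟩)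

theorem not_parallel_of {X : P} {l m : L} (h1 : X ∈ l) (h2 : X ∈ m) (hne : l ≠ m) :
    ¬ LineParallel P l m := fun hp => hne (parallel_eq hp h1 h2)

theorem notMem_of_parallel {X : P} {l m : L} (hp : LineParallel P l m) {Y : P} (hY : Y ∈ m)
    (hYl : Y ∉ l) (hX : X ∈ m) : X ∉ l := fun hl => hYl (parallel_eq hp hl hX ▸ hY)

variable [DesarguesAffinePlane P L]

theorem line_eq {X Y : P} {l m : L} (h : X ≠ Y) (h1 : X ∈ l) (h2 : Y ∈ l) (h3 : X ∈ m)
    (h4 : Y ∈ m) : l = m :=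
  (existsUnique_line (L := L) X Y h).unique ⟨h1, h2⟩ ⟨h3, h4⟩

theorem parallel_trans {l m n : L} (h : LineParallel P l m) (h' : LineParallel P m n) :
    LineParallel P l n := by
  rcases h with rfl | h
  · exact h'
  rcases h' with rfl | h'
  · exact Or.inr h
  by_cases hX : ∃ X : P, X ∈ l ∧ X ∈ n
  · obtain ⟨X, hl, hn⟩ := hX
    exact Or.inl ((playfair X m (h X hl)).unique ⟨hl, fun Y hm hl' => h Y hl' hm⟩ ⟨hn, h'⟩)
  · exact Or.inr fun X hl hn => hX ⟨X, hl, hn⟩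

theorem existsUnique_parallel (X : P) (l : L) : ∃! m : L, X ∈ m ∧ LineParallel P l m := by
  by_cases hX : X ∈ l
  · exact ⟨l, ⟨hX, parallel_refl l⟩, fun m hm => (parallel_eq hm.2 hX hm.1).symm⟩
  · obtain ⟨m, hm, hu⟩ := playfair X l hX
    refine ⟨m, ⟨hm.1, Or.inr hm.2⟩, fun n hn => hu n ⟨hn.1, ?_⟩⟩
    rcases hn.2 with rfl | h
    · exact absurd hn.1 hX
    · exact h

variable (L) in
/-- The line through two distinct points. -/
noncomputable def join {X Y : P} (h : X ≠ Y) : L := (existsUnique_line (L := L) X Y h).choose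

/-- The line through `X` parallel to `l`. -/
noncomputable def parallelThrough (X : P) (l : L) : L := (existsUnique_parallel X l).choose

theorem left_mem_join {X Y : P} (h : X ≠ Y) : X ∈ join L h :=
  (existsUnique_line (L := L) X Y h).choose_spec.1.1

theorem right_mem_join {X Y : P} (h : X ≠ Y) : Y ∈ join L h :=
  (existsUnique_line (L := L) X Y h).choose_spec.1.2

theorem mem_parallelThrough (X : P) (l : L) : X ∈ parallelThrough X l :=
  (existsUnique_parallel X l).choose_spec.1.1

theorem parallel_parallelThrough (X : P) (l : L) : LineParallel P l (parallelThrough X l) :=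
  (existsUnique_parallel X l).choose_spec.1.2

theorem parallelThrough_eq {X : P} {l m : L} (h : X ∈ m) (h' : LineParallel P l m) :
    parallelThrough X l = m :=
  (existsUnique_parallel X l).unique (existsUnique_parallel X l).choose_spec.1 ⟨h, h'⟩

variable (P) in
theorem exists_notMem (l : L) : ∃ X : P, X ∉ l := by
  obtain ⟨X, Y, Z, -, -, -, h⟩ := exists_noncollinear (P := P) (L := L)
  by_contra hc
  push Not at hc
  exact h ⟨l, hc X, hc Y, hc Z⟩

/-- If `B₁ ↦ P₁` and `B₂ ↦ P₂` are both obtained from `U ↦ A`, then they transport `B` to the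
same point `S`. -/
theorem transfer {U A B S B₁ P₁ B₂ P₂ : P} {l b c u₁ a₁ u₂ a₂ s₁ t₁ s₂ t₂ : L}
    (hUA : U ≠ A) (hU : U ∈ l) (hA : A ∈ l) (hB : B ∈ l) (hS : S ∈ l)
    (hb : B₁ ∈ b) (hb' : P₁ ∈ b) (hc : B₂ ∈ c) (hc' : P₂ ∈ c)
    (hp : (LineParallel P b l ∧ LineParallel P l c) ∨ ∃ V : P, V ∈ b ∧ V ∈ l ∧ V ∈ c)
    (n1 : B₁ ∉ l) (n2 : P₁ ∉ l) (n3 : B₂ ∉ l) (n4 : P₂ ∉ l) (n5 : B₁ ∉ c) (n6 : P₁ ∉ c)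
    (n7 : B ∉ b)
    (k1 : U ∈ u₁) (k2 : B₁ ∈ u₁) (k3 : A ∈ a₁) (k4 : P₁ ∈ a₁) (k5 : LineParallel P u₁ a₁)
    (k6 : U ∈ u₂) (k7 : B₂ ∈ u₂) (k8 : A ∈ a₂) (k9 : P₂ ∈ a₂) (k10 : LineParallel P u₂ a₂)
    (j1 : B ∈ s₁) (j2 : B₁ ∈ s₁) (j3 : S ∈ t₁) (j4 : P₁ ∈ t₁) (j5 : LineParallel P s₁ t₁)
    (j6 : B ∈ s₂) (j7 : B₂ ∈ s₂) (j8 : S ∈ t₂) (j9 : P₂ ∈ t₂) : LineParallel P s₂ t₂ := by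
  have ne {X Y : P} {m : L} (h : X ∈ m) (h' : Y ∉ m) : X ≠ Y := fun e => h' (e ▸ h)
  have hu1 : u₁ ≠ a₁ := by
    rintro rfl
    exact n1 (line_eq hUA k1 k3 hU hA ▸ k2)
  have hu2 : u₂ ≠ a₂ := by
    rintro rfl
    exact n3 (line_eq hUA k6 k8 hU hA ▸ k7)
  have hBP : B₁ ≠ P₁ := by
    rintro rfl
    exact hu1 (parallel_eq k5 k2 k4)
  have hBP2 : B₂ ≠ P₂ := by
    rintro rfl
    exact hu2 (parallel_eq k10 k7 k9)
  have hbl : b ≠ l := by rintro rfl; exact n1 hb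
  have hcl : l ≠ c := by rintro rfl; exact n3 hc
  have hbc : b ≠ c := by rintro rfl; exact n5 hb
  have d12 : B₁ ≠ B₂ := (ne hc n5).symm
  have d12' : P₁ ≠ P₂ := (ne hc' n6).symm
  have hdes := desargues B₁ U B₂ P₁ A P₂ b l c u₁ u₂ (join L d12) a₁ a₂ (join L d12')
    hBP hUA hBP2 (ne hU n1).symm (ne hU n3) d12 (ne hA n2).symm (ne hA n4) d12'
    hb hb' hU hA hc hc' hbl hcl hbc hp k2 k1 k6 k7 (left_mem_join _) (right_mem_join _)
    k4 k3 k8 k9 (left_mem_join _) (right_mem_join _) hu1 hu2 k5 k10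
  have hst : s₁ ≠ t₁ := by
    rintro rfl
    exact n7 (line_eq hBP j2 j4 hb hb' ▸ j1)
  have hBS : B ≠ S := by
    rintro rfl
    exact hst (parallel_eq j5 j1 j3)
  have hjj : join L d12 ≠ join L d12' := by
    intro e
    have h1 := line_eq hBP (left_mem_join (L := L) d12) (e ▸ left_mem_join (L := L) d12') hb hb'
    have h2 := line_eq hBP2 (right_mem_join (L := L) d12)
      (e ▸ right_mem_join (L := L) d12') hc hc'
    exact hbc (h1.symm.trans h2)
  refine desargues B B₁ B₂ S P₁ P₂ l b c s₁ (join L d12) s₂ t₁ (join L d12') t₂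
    hBS hBP hBP2 (ne hB n1) d12 (ne hB n3) (ne hS n2) d12' (ne hS n4)
    hB hS hb hb' hc hc' hbl.symm hbc hcl ?_ j1 j2 (left_mem_join _) (right_mem_join _) j6 j7
    j3 j4 (left_mem_join _) (right_mem_join _) j8 j9 hst hjj j5 hdes
  rcases hp with ⟨h1, h2⟩ | ⟨V, h1, h2, h3⟩
  · exact Or.inl ⟨parallel_symm h1, parallel_trans h1 h2⟩
  · exact Or.inr ⟨V, h2, h1, h3⟩

end DesarguesAffinePlane

open DesarguesAffinePlane

variable [DesarguesAffinePlane P L] {O I : P}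

variable (L) in
/-- The points of the line `OI`. -/
def CoordLine (h : O ≠ I) : Type _ :=
  {X : P // X ∈ join L h}

namespace CoordLine

variable {h : O ≠ I}

/-- The point `O` is the zero of the line `OI`. -/
instance : Zero (CoordLine L h) := ⟨⟨O, left_mem_join h⟩⟩

/-- The point `I` is the unit of the line `OI`. -/
instance : One (CoordLine L h) := ⟨⟨I, right_mem_join h⟩⟩

theorem ne_of_notMem (A : CoordLine L h) {B₁ : P} (hB₁ : B₁ ∉ join L h) : A.1 ≠ B₁ :=
  fun e => hB₁ (e ▸ A.2)

theorem zero_ne_one : (0 : CoordLine L h) ≠ 1 := fun e => h (congrArg Subtype.val e)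

/-- The addition algorithm run with the auxiliary point `B₁` off the line `OI` yields `S`:
`P₁` is the intersection of the parallel to `OI` through `B₁` with the parallel to `OB₁`
through `A`, and `S` lies on the parallel to `BB₁` through `P₁`. -/
def IsSumVia {B₁ : P} (hB₁ : B₁ ∉ join L h) (A B S : CoordLine L h) : Prop :=
  ∃ P₁ : P, P₁ ∈ parallelThrough B₁ (join L h) ∧
    P₁ ∈ parallelThrough A.1 (join L (ne_of_notMem (0 : CoordLine L h) hB₁)) ∧
    S.1 ∈ parallelThrough P₁ (join L (ne_of_notMem B hB₁))

/-- The multiplication algorithm run with the auxiliary point `B₁` off the line `OI` yields `S`: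
`P₁` is the intersection of the parallel to `IB₁` through `A` with the line `OB₁`, and `S` lies
on the parallel to `BB₁` through `P₁`. -/
def IsProdVia {B₁ : P} (hB₁ : B₁ ∉ join L h) (A B S : CoordLine L h) : Prop :=
  ∃ P₁ : P, P₁ ∈ parallelThrough A.1 (join L (ne_of_notMem (1 : CoordLine L h) hB₁)) ∧
    P₁ ∈ join L (ne_of_notMem (0 : CoordLine L h) hB₁) ∧
    S.1 ∈ parallelThrough P₁ (join L (ne_of_notMem B hB₁))

/-- `S` is obtained by the addition algorithm from `A` and `B`. -/
def IsSum (A B S : CoordLine L h) : Prop :=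
  ∃ (B₁ : P) (hB₁ : B₁ ∉ join L h), IsSumVia hB₁ A B S

/-- `S` is obtained by the multiplication algorithm from `A` and `B`. -/
def IsProd (A B S : CoordLine L h) : Prop :=
  ∃ (B₁ : P) (hB₁ : B₁ ∉ join L h), IsProdVia hB₁ A B S

/-! Both algorithms can be carried out, and their outcome is independent of `B₁`. -/

theorem join_not_parallel (A : CoordLine L h) {B₁ : P} (hB₁ : B₁ ∉ join L h) :
    ¬ LineParallel P (join L (ne_of_notMem A hB₁)) (join L h) :=
  not_parallel_of (left_mem_join _) A.2 fun e => hB₁ (e ▸ right_mem_join _)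

theorem sum_step (A : CoordLine L h) {B₁ : P} (hB₁ : B₁ ∉ join L h) :
    ∃! P₁ : P, P₁ ∈ parallelThrough B₁ (join L h) ∧
      P₁ ∈ parallelThrough A.1 (join L (ne_of_notMem (0 : CoordLine L h) hB₁)) := by
  have hnp : ¬ LineParallel P (parallelThrough B₁ (join L h))
      (parallelThrough A.1 (join L (ne_of_notMem (0 : CoordLine L h) hB₁))) := fun hp =>
    join_not_parallel 0 hB₁ (parallel_trans (parallel_parallelThrough A.1 _)
      (parallel_trans (parallel_symm hp) (parallel_symm (parallel_parallelThrough B₁ _))))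
  obtain ⟨X, h1, h2⟩ := exists_meet hnp
  refine ⟨X, ⟨h1, h2⟩, fun Y hY => ?_⟩
  by_contra hne
  exact hnp (Or.inl (line_eq hne hY.1 h1 hY.2 h2))

theorem prod_step (A : CoordLine L h) {B₁ : P} (hB₁ : B₁ ∉ join L h) :
    ∃! P₁ : P, P₁ ∈ parallelThrough A.1 (join L (ne_of_notMem (1 : CoordLine L h) hB₁)) ∧
      P₁ ∈ join L (ne_of_notMem (0 : CoordLine L h) hB₁) := by
  have hnp : ¬ LineParallel P
      (parallelThrough A.1 (join L (ne_of_notMem (1 : CoordLine L h) hB₁)))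
      (join L (ne_of_notMem (0 : CoordLine L h) hB₁)) := fun hp => by
    have e := parallel_eq (parallel_trans (parallel_parallelThrough A.1 _) hp)
      (right_mem_join _) (right_mem_join _)
    have h1 : I ∈ join L (ne_of_notMem (0 : CoordLine L h) hB₁) :=
      e ▸ left_mem_join (ne_of_notMem (1 : CoordLine L h) hB₁)
    have h0 : O ∈ join L (ne_of_notMem (0 : CoordLine L h) hB₁) := left_mem_join _
    exact hB₁ (line_eq h h0 h1 (left_mem_join h) (right_mem_join h) ▸ right_mem_join _)
  obtain ⟨X, h1, h2⟩ := exists_meet hnp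
  refine ⟨X, ⟨h1, h2⟩, fun Y hY => ?_⟩
  by_contra hne
  exact hnp (Or.inl (line_eq hne hY.1 h1 hY.2 h2))

theorem last_step (B : CoordLine L h) {B₁ : P} (hB₁ : B₁ ∉ join L h) (P₁ : P) :
    ∃! S : CoordLine L h, S.1 ∈ parallelThrough P₁ (join L (ne_of_notMem B hB₁)) := by
  have hnp : ¬ LineParallel P (parallelThrough P₁ (join L (ne_of_notMem B hB₁))) (join L h) :=
    fun hp => join_not_parallel B hB₁ (parallel_trans (parallel_parallelThrough P₁ _) hp)
  obtain ⟨X, h1, h2⟩ := exists_meet hnp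
  refine ⟨⟨X, h2⟩, h1, fun Y hY => Subtype.ext ?_⟩
  by_contra hne
  exact hnp (Or.inl (line_eq hne hY h1 Y.2 h2))

theorem existsUnique_isSumVia (A B : CoordLine L h) {B₁ : P} (hB₁ : B₁ ∉ join L h) :
    ∃! S, IsSumVia hB₁ A B S := by
  obtain ⟨P₁, ⟨h1, h2⟩, hu⟩ := sum_step A hB₁
  obtain ⟨S, hS, hSu⟩ := last_step B hB₁ P₁
  refine ⟨S, ⟨P₁, h1, h2, hS⟩, ?_⟩
  rintro T ⟨Q, h3, h4, hT⟩
  obtain rfl := hu Q ⟨h3, h4⟩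
  exact hSu T hT

theorem existsUnique_isProdVia (A B : CoordLine L h) {B₁ : P} (hB₁ : B₁ ∉ join L h) :
    ∃! S, IsProdVia hB₁ A B S := by
  obtain ⟨P₁, ⟨h1, h2⟩, hu⟩ := prod_step A hB₁
  obtain ⟨S, hS, hSu⟩ := last_step B hB₁ P₁
  refine ⟨S, ⟨P₁, h1, h2, hS⟩, ?_⟩
  rintro T ⟨Q, h3, h4, hT⟩
  obtain rfl := hu Q ⟨h3, h4⟩
  exact hSu T hT

theorem self_of_aux (B : CoordLine L h) {B₁ : P} (hB₁ : B₁ ∉ join L h) :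
    B.1 ∈ parallelThrough B₁ (join L (ne_of_notMem B hB₁)) := by
  rw [parallelThrough_eq (right_mem_join _) (parallel_refl _)]
  exact left_mem_join _

theorem isSumVia_zero_left (B : CoordLine L h) {B₁ : P} (hB₁ : B₁ ∉ join L h) :
    IsSumVia hB₁ 0 B B := by
  refine ⟨B₁, mem_parallelThrough _ _, ?_, self_of_aux B hB₁⟩
  rw [parallelThrough_eq (left_mem_join _) (parallel_refl _)]
  exact right_mem_join _

theorem isSumVia_zero_right (A : CoordLine L h) {B₁ : P} (hB₁ : B₁ ∉ join L h) :
    IsSumVia hB₁ A 0 A := by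
  obtain ⟨P₁, ⟨h1, h2⟩, -⟩ := sum_step A hB₁
  refine ⟨P₁, h1, h2, ?_⟩
  rw [parallelThrough_eq h2 (parallel_parallelThrough _ _)]
  exact mem_parallelThrough _ _

theorem isProdVia_one_left (B : CoordLine L h) {B₁ : P} (hB₁ : B₁ ∉ join L h) :
    IsProdVia hB₁ 1 B B := by
  refine ⟨B₁, ?_, right_mem_join _, self_of_aux B hB₁⟩
  rw [parallelThrough_eq (left_mem_join _) (parallel_refl _)]
  exact right_mem_join _

theorem isProdVia_zero_left (B : CoordLine L h) {B₁ : P} (hB₁ : B₁ ∉ join L h) :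
    IsProdVia hB₁ 0 B 0 :=
  ⟨O, mem_parallelThrough _ _, left_mem_join _, mem_parallelThrough _ _⟩

theorem isProdVia_zero_right (A : CoordLine L h) {B₁ : P} (hB₁ : B₁ ∉ join L h) :
    IsProdVia hB₁ A 0 0 := by
  obtain ⟨P₁, ⟨h1, h2⟩, -⟩ := prod_step A hB₁
  refine ⟨P₁, h1, h2, ?_⟩
  rw [parallelThrough_eq h2 (parallel_refl _)]
  exact left_mem_join _

theorem isSumVia_transfer {A B S : CoordLine L h} {B₁ B₂ : P} (hB₁ : B₁ ∉ join L h)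
    (hB₂ : B₂ ∉ join L h) (hne : B₁ ∉ parallelThrough B₂ (join L h))
    (H : IsSumVia hB₁ A B S) : IsSumVia hB₂ A B S := by
  by_cases hA : (0 : CoordLine L h) = A
  · subst hA
    rw [(existsUnique_isSumVia 0 B hB₁).unique H (isSumVia_zero_left B hB₁)]
    exact isSumVia_zero_left B hB₂
  have hA' : O ≠ A.1 := fun e => hA (Subtype.ext e)
  obtain ⟨P₁, h1, h2, h3⟩ := H
  obtain ⟨P₂, ⟨h4, h5⟩, -⟩ := sum_step A hB₂
  have q1 := parallel_parallelThrough B₁ (join L h)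
  have q2 := parallel_parallelThrough B₂ (join L h)
  have n2 : P₁ ∉ join L h := notMem_of_parallel q1 (mem_parallelThrough _ _) hB₁ h1
  have n4 : P₂ ∉ join L h := notMem_of_parallel q2 (mem_parallelThrough _ _) hB₂ h4
  have n6 : P₁ ∉ parallelThrough B₂ (join L h) :=
    notMem_of_parallel (parallel_trans (parallel_symm q2) q1) (mem_parallelThrough _ _) hne h1
  have n7 : B.1 ∉ parallelThrough B₁ (join L h) := fun hB =>
    hB₁ (parallel_eq q1 B.2 hB ▸ mem_parallelThrough _ _)
  refine ⟨P₂, h4, h5, ?_⟩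
  have hSP : S.1 ≠ P₂ := fun e => n4 (e ▸ S.2)
  have := transfer hA' (left_mem_join h) A.2 B.2 S.2 (mem_parallelThrough _ _) h1
    (mem_parallelThrough _ _) h4 (Or.inl ⟨parallel_symm q1, q2⟩) hB₁ n2 hB₂ n4 hne n6 n7
    (left_mem_join _) (right_mem_join _) (mem_parallelThrough _ _) h2
    (parallel_parallelThrough _ _)
    (left_mem_join _) (right_mem_join _) (mem_parallelThrough _ _) h5
    (parallel_parallelThrough _ _)
    (left_mem_join (ne_of_notMem B hB₁)) (right_mem_join _) h3 (mem_parallelThrough _ _)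
    (parallel_parallelThrough _ _)
    (left_mem_join (ne_of_notMem B hB₂)) (right_mem_join _) (left_mem_join hSP)
    (right_mem_join hSP)
  rw [parallelThrough_eq (right_mem_join hSP) this]
  exact left_mem_join hSP

theorem prod_notMem {A : CoordLine L h} (hA : 0 ≠ A) {B₁ P₁ : P} (hB₁ : B₁ ∉ join L h)
    (h1 : P₁ ∈ parallelThrough A.1 (join L (ne_of_notMem (1 : CoordLine L h) hB₁)))
    (h2 : P₁ ∈ join L (ne_of_notMem (0 : CoordLine L h) hB₁)) : P₁ ∉ join L h := by
  intro hP
  have hA' : O ≠ A.1 := fun e => hA (Subtype.ext e)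
  have e : P₁ = O := by
    by_contra hne
    have := line_eq hne h2 (left_mem_join (ne_of_notMem (0 : CoordLine L h) hB₁)) hP
      (left_mem_join h)
    exact hB₁ (this ▸ right_mem_join _)
  rw [e] at h1
  have e2 := line_eq hA' h1 (mem_parallelThrough _ _) (left_mem_join h) A.2
  have := parallel_parallelThrough A.1 (join L (ne_of_notMem (1 : CoordLine L h) hB₁))
  rw [e2] at this
  exact join_not_parallel 1 hB₁ this

theorem isProdVia_transfer {A B S : CoordLine L h} {B₁ B₂ : P} (hB₁ : B₁ ∉ join L h)
    (hB₂ : B₂ ∉ join L h) (hne : B₁ ∉ join L (ne_of_notMem (0 : CoordLine L h) hB₂))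
    (H : IsProdVia hB₁ A B S) : IsProdVia hB₂ A B S := by
  by_cases hA : 0 = A
  · subst hA
    rw [(existsUnique_isProdVia 0 B hB₁).unique H (isProdVia_zero_left B hB₁)]
    exact isProdVia_zero_left B hB₂
  by_cases hA1 : 1 = A
  · subst hA1
    rw [(existsUnique_isProdVia 1 B hB₁).unique H (isProdVia_one_left B hB₁)]
    exact isProdVia_one_left B hB₂
  by_cases hB : B = 0
  · subst hB
    rw [(existsUnique_isProdVia A 0 hB₁).unique H (isProdVia_zero_right A hB₁)]
    exact isProdVia_zero_right A hB₂
  have hA' : O ≠ A.1 := fun e => hA (Subtype.ext e)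
  have hA1' : I ≠ A.1 := fun e => hA1 (Subtype.ext e)
  obtain ⟨P₁, h1, h2, h3⟩ := H
  obtain ⟨P₂, ⟨h4, h5⟩, -⟩ := prod_step A hB₂
  have n2 := prod_notMem hA hB₁ h1 h2
  have n4 := prod_notMem hA hB₂ h4 h5
  have hO : ∀ {B₁ : P} (hB₁ : B₁ ∉ join L h),
      O ∈ join L (ne_of_notMem (0 : CoordLine L h) hB₁) := fun _ => left_mem_join _
  have n6 : P₁ ∉ join L (ne_of_notMem (0 : CoordLine L h) hB₂) := fun hP => by
    have hPO : O ≠ P₁ := fun e => n2 (e ▸ left_mem_join h)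
    exact hne (line_eq hPO (hO hB₁) h2 (hO hB₂) hP ▸ right_mem_join _)
  have n7 : B.1 ∉ join L (ne_of_notMem (0 : CoordLine L h) hB₁) := fun hBm => by
    have hBO : O ≠ B.1 := fun e => hB (Subtype.ext e.symm)
    exact hB₁ (line_eq hBO (hO hB₁) hBm (left_mem_join h) B.2 ▸ right_mem_join _)
  refine ⟨P₂, h4, h5, ?_⟩
  have hSP : S.1 ≠ P₂ := fun e => n4 (e ▸ S.2)
  have := transfer hA1' (right_mem_join h) A.2 B.2 S.2 (right_mem_join _) h2
    (right_mem_join _) h5 (Or.inr ⟨O, hO hB₁, left_mem_join h, hO hB₂⟩) hB₁ n2 hB₂ n4 hne n6 n7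
    (left_mem_join _) (right_mem_join _) (mem_parallelThrough _ _) h1
    (parallel_parallelThrough _ _)
    (left_mem_join _) (right_mem_join _) (mem_parallelThrough _ _) h4
    (parallel_parallelThrough _ _)
    (left_mem_join (ne_of_notMem B hB₁)) (right_mem_join _) h3 (mem_parallelThrough _ _)
    (parallel_parallelThrough _ _)
    (left_mem_join (ne_of_notMem B hB₂)) (right_mem_join _) (left_mem_join hSP)
    (right_mem_join hSP)
  rw [parallelThrough_eq (right_mem_join hSP) this]
  exact left_mem_join hSP

theorem isProdVia_indep {A B S : CoordLine L h} {B₁ B₂ : P} (hB₁ : B₁ ∉ join L h)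
    (hB₂ : B₂ ∉ join L h) (H : IsProdVia hB₁ A B S) : IsProdVia hB₂ A B S := by
  by_cases hne : B₁ ∈ join L (ne_of_notMem (0 : CoordLine L h) hB₂)
  swap
  · exact isProdVia_transfer hB₁ hB₂ hne H
  have hO : ∀ {B₁ : P} (hB₁ : B₁ ∉ join L h),
      O ∈ join L (ne_of_notMem (0 : CoordLine L h) hB₁) := fun _ => left_mem_join _
  have hOB : O ≠ B₁ := ne_of_notMem (0 : CoordLine L h) hB₁
  have e : join L (ne_of_notMem (0 : CoordLine L h) hB₁)
      = join L (ne_of_notMem (0 : CoordLine L h) hB₂) :=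
    line_eq hOB (hO hB₁) (right_mem_join _) (hO hB₂) hne
  have q := parallel_parallelThrough B₁ (join L h)
  obtain ⟨M, ⟨hM1, hM2⟩, -⟩ := sum_step (1 : CoordLine L h) hB₁
  have hM : M ∉ join L h := notMem_of_parallel q (mem_parallelThrough _ _) hB₁ hM1
  have hI : I ∉ join L (ne_of_notMem (0 : CoordLine L h) hB₁) := fun hI =>
    hB₁ (line_eq h (hO hB₁) hI (left_mem_join h) (right_mem_join h) ▸ right_mem_join _)
  have hM' : M ∉ join L (ne_of_notMem (0 : CoordLine L h) hB₁) := notMem_of_parallel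
    (parallel_parallelThrough (1 : CoordLine L h).1 _) (mem_parallelThrough _ _) hI hM2
  have hOM : O ≠ M := ne_of_notMem (0 : CoordLine L h) hM
  refine isProdVia_transfer hM hB₂ (e ▸ hM') (isProdVia_transfer hB₁ hM (fun hB => ?_) H)
  exact hM' (line_eq hOB (hO hM) hB (hO hB₁) (right_mem_join _) ▸ right_mem_join _)

theorem isSumVia_indep {A B S : CoordLine L h} {B₁ B₂ : P} (hB₁ : B₁ ∉ join L h)
    (hB₂ : B₂ ∉ join L h) (H : IsSumVia hB₁ A B S) : IsSumVia hB₂ A B S := by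
  by_cases hne : B₁ ∈ parallelThrough B₂ (join L h)
  swap
  · exact isSumVia_transfer hB₁ hB₂ hne H
  have q1 := parallel_parallelThrough B₁ (join L h)
  have q2 := parallel_parallelThrough B₂ (join L h)
  have e : parallelThrough B₁ (join L h) = parallelThrough B₂ (join L h) :=
    parallelThrough_eq hne q2
  by_cases hM : ∃ M : P, M ∉ join L h ∧ M ∉ parallelThrough B₁ (join L h)
  · obtain ⟨M, hM, hM'⟩ := hM
    refine isSumVia_transfer hM hB₂ (e ▸ hM') (isSumVia_transfer hB₁ hM (fun hB => hM' ?_) H)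
    rw [parallelThrough_eq hB (parallel_parallelThrough M _)]
    exact mem_parallelThrough _ _
  push Not at hM
  by_cases hA : 0 = A
  · subst hA
    rw [(existsUnique_isSumVia 0 B hB₁).unique H (isSumVia_zero_left B hB₁)]
    exact isSumVia_zero_left B hB₂
  by_cases hB : B = 0
  · subst hB
    rw [(existsUnique_isSumVia A 0 hB₁).unique H (isSumVia_zero_right A hB₁)]
    exact isSumVia_zero_right A hB₂
  -- only two parallels to `OI`: the line `OI` has only two points
  have two : ∀ X : CoordLine L h, X = 0 ∨ X = 1 := by
    intro X
    by_contra hX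
    push Not at hX
    obtain ⟨R, ⟨r1, r2⟩, -⟩ := prod_step X hB₁
    have r3 := hM R (prod_notMem hX.1.symm hB₁ r1 r2)
    have hRB : R = B₁ := by
      by_contra hn
      have := line_eq hn r2 (right_mem_join _) r3 (mem_parallelThrough _ _)
      exact join_not_parallel 0 hB₁ (this ▸ parallel_symm q1)
    subst hRB
    have e3 := parallel_eq (parallel_parallelThrough X.1 _) (right_mem_join _) r1
    have hXm : X.1 ∈ join L (ne_of_notMem (1 : CoordLine L h) hB₁) :=
      e3 ▸ mem_parallelThrough _ _
    have hXI : I ≠ X.1 := fun e => hX.2 (Subtype.ext e.symm)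
    have hI : I ∈ join L (ne_of_notMem (1 : CoordLine L h) hB₁) := left_mem_join _
    exact hB₁ (line_eq hXI hI hXm (right_mem_join h) X.2 ▸ right_mem_join _)
  have key : ∀ {B₁ : P} (hB₁ : B₁ ∉ join L h) (S : CoordLine L h), IsSumVia hB₁ A B S → S ≠ B := by
    rintro B₁ hB₁ S ⟨P₁, h1, h2, h3⟩ rfl
    have hA' : O ≠ A.1 := fun e => hA (Subtype.ext e)
    have q := parallel_parallelThrough P₁ (join L (ne_of_notMem S hB₁))
    have q' := parallel_parallelThrough B₁ (join L h)
    have e1 := parallel_eq q (left_mem_join _) h3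
    have hP : P₁ ∈ join L (ne_of_notMem S hB₁) := e1 ▸ mem_parallelThrough _ _
    have hPB : P₁ = B₁ := by
      by_contra hn
      have := line_eq hn hP (right_mem_join _) h1 (mem_parallelThrough _ _)
      exact join_not_parallel S hB₁ (this ▸ parallel_symm q')
    subst hPB
    have e2 := parallel_eq (parallel_parallelThrough A.1 _) (right_mem_join _) h2
    have hAm : A.1 ∈ join L (ne_of_notMem (0 : CoordLine L h) hB₁) :=
      e2 ▸ mem_parallelThrough _ _
    have hO : O ∈ join L (ne_of_notMem (0 : CoordLine L h) hB₁) := left_mem_join _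
    exact hB₁ (line_eq hA' hO hAm (left_mem_join h) A.2 ▸ right_mem_join _)
  obtain ⟨T, hT, -⟩ := existsUnique_isSumVia A B hB₂
  have k1 := key hB₁ S H
  have k2 := key hB₂ T hT
  have hB' := (two B).resolve_left hB
  have : S = T := by
    rw [hB'] at k1 k2
    rw [(two S).resolve_right k1, (two T).resolve_right k2]
  exact this ▸ hT

theorem existsUnique_isSum (A B : CoordLine L h) : ∃! S, IsSum A B S := by
  obtain ⟨B₁, hB₁⟩ := exists_notMem P (join L h)
  obtain ⟨S, hS, hu⟩ := existsUnique_isSumVia A B hB₁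
  exact ⟨S, ⟨B₁, hB₁, hS⟩, fun T ⟨B₂, hB₂, hT⟩ => hu T (isSumVia_indep hB₂ hB₁ hT)⟩

theorem existsUnique_isProd (A B : CoordLine L h) : ∃! S, IsProd A B S := by
  obtain ⟨B₁, hB₁⟩ := exists_notMem P (join L h)
  obtain ⟨S, hS, hu⟩ := existsUnique_isProdVia A B hB₁
  exact ⟨S, ⟨B₁, hB₁, hS⟩, fun T ⟨B₂, hB₂, hT⟩ => hu T (isProdVia_indep hB₂ hB₁ hT)⟩

/-- Addition of points of the line `OI`. -/
noncomputable instance : Add (CoordLine L h) := ⟨fun A B => (existsUnique_isSum A B).choose⟩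

/-- Multiplication of points of the line `OI`. -/
noncomputable instance : Mul (CoordLine L h) := ⟨fun A B => (existsUnique_isProd A B).choose⟩

theorem add_eq_iff {A B S : CoordLine L h} : A + B = S ↔ IsSum A B S :=
  ⟨fun e => e ▸ (existsUnique_isSum A B).choose_spec.1,
    fun hS => (existsUnique_isSum A B).unique (existsUnique_isSum A B).choose_spec.1 hS⟩

theorem mul_eq_iff {A B S : CoordLine L h} : A * B = S ↔ IsProd A B S :=
  ⟨fun e => e ▸ (existsUnique_isProd A B).choose_spec.1,
    fun hS => (existsUnique_isProd A B).unique (existsUnique_isProd A B).choose_spec.1 hS⟩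

theorem solve_last {B₁ P₁ : P} (hB₁ : B₁ ∉ join L h) (hP₁ : P₁ ∉ join L h)
    (T : CoordLine L h) :
    ∃! Y : CoordLine L h, T.1 ∈ parallelThrough P₁ (join L (ne_of_notMem Y hB₁)) := by
  have hTP : T.1 ≠ P₁ := ne_of_notMem T hP₁
  have q := parallel_parallelThrough B₁ (join L hTP)
  have hnp : ¬ LineParallel P (parallelThrough B₁ (join L hTP)) (join L h) := fun hp =>
    join_not_parallel T hP₁ (parallel_trans q hp)
  obtain ⟨X, h1, h2⟩ := exists_meet hnp
  refine ⟨⟨X, h2⟩, ?_, fun Y hY => Subtype.ext ?_⟩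
  · have hX : X ≠ B₁ := fun e => hB₁ (e ▸ h2)
    have e := line_eq hX (left_mem_join hX) (right_mem_join (L := L) hX) h1
      (mem_parallelThrough _ _)
    change T.1 ∈ parallelThrough P₁ (join L hX)
    rw [parallelThrough_eq (right_mem_join hTP) (e ▸ parallel_symm q)]
    exact left_mem_join _
  · have e := line_eq hTP hY (mem_parallelThrough _ _) (left_mem_join hTP) (right_mem_join hTP)
    have q' := parallel_parallelThrough P₁ (join L (ne_of_notMem Y hB₁))
    rw [e] at q'
    have e' := parallelThrough_eq (right_mem_join _) (parallel_symm q')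
    by_contra hne
    exact hnp (Or.inl (line_eq hne (e' ▸ left_mem_join _) h1 Y.2 h2))

theorem existsUnique_add_eq_zero (A : CoordLine L h) : ∃! Y, A + Y = 0 := by
  obtain ⟨B₁, hB₁⟩ := exists_notMem P (join L h)
  obtain ⟨P₁, ⟨h1, h2⟩, hu⟩ := sum_step A hB₁
  have hP₁ : P₁ ∉ join L h :=
    notMem_of_parallel (parallel_parallelThrough B₁ _) (mem_parallelThrough _ _) hB₁ h1
  obtain ⟨Y, hY, hYu⟩ := solve_last hB₁ hP₁ 0
  refine ⟨Y, add_eq_iff.2 ⟨B₁, hB₁, P₁, h1, h2, hY⟩, fun Z hZ => hYu Z ?_⟩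
  obtain ⟨B₂, hB₂, hZ⟩ := add_eq_iff.1 hZ
  obtain ⟨Q, h3, h4, h5⟩ := isSumVia_indep hB₂ hB₁ hZ
  obtain rfl := hu Q ⟨h3, h4⟩
  exact h5

theorem existsUnique_mul_eq_one {A : CoordLine L h} (hA : A ≠ 0) : ∃! Y, A * Y = 1 := by
  obtain ⟨B₁, hB₁⟩ := exists_notMem P (join L h)
  obtain ⟨P₁, ⟨h1, h2⟩, hu⟩ := prod_step A hB₁
  have hP₁ : P₁ ∉ join L h := prod_notMem hA.symm hB₁ h1 h2
  obtain ⟨Y, hY, hYu⟩ := solve_last hB₁ hP₁ 1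
  refine ⟨Y, mul_eq_iff.2 ⟨B₁, hB₁, P₁, h1, h2, hY⟩, fun Z hZ => hYu Z ?_⟩
  obtain ⟨B₂, hB₂, hZ⟩ := mul_eq_iff.1 hZ
  obtain ⟨Q, h3, h4, h5⟩ := isProdVia_indep hB₂ hB₁ hZ
  obtain rfl := hu Q ⟨h3, h4⟩
  exact h5

/-- `-A` is the point with `A + (-A) = O`. -/
noncomputable instance : Neg (CoordLine L h) := ⟨fun A => (existsUnique_add_eq_zero A).choose⟩

/-- `A - B = A + (-B)`. -/
noncomputable instance : Sub (CoordLine L h) := ⟨fun A B => A + -B⟩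

open Classical in
/-- For `A ≠ O`, `A⁻¹` is the point with `A * A⁻¹ = I`; the inverse of `O` is a dummy value. -/
noncomputable instance : Inv (CoordLine L h) :=
  ⟨fun A => if hA : A ≠ 0 then (existsUnique_mul_eq_one hA).choose else 0⟩

/-- The cross-ratio `c_r(A, B; C, D)`; it is meaningful when `A ≠ D` and `B ≠ C`. -/
noncomputable def crossRatio (A B C D : CoordLine L h) : CoordLine L h :=
  ((A - D)⁻¹ * (B - D)) * ((B - C)⁻¹ * (A - C))

/-- The Möbius transform `μ(X) = c_r(X, B; C, D)` with base points `B`, `C`, `D`. -/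
noncomputable def mobius (B C D X : CoordLine L h) : CoordLine L h := crossRatio X B C D

end CoordLine

end Plane

/-! Only the last claim depends on the form of `mobius`: the factor `C - C` is `O`, and a product
with right factor `O` is `O`. Everything else is the statement that addition on the line `OI` is
associative and commutative with zero `O`, valid for arbitrary points of that line.

These laws come from translations. By the Desargues axiom, `X ↦ A + X` extends to a dilation of the
whole plane that moves every point in the direction of `OI` (`exists_translation`). Such a map is
determined by a single value (`eq_of_agree`). Hence the translation of `A + B` is the composite of
those of `A` and `B`, as both send `O` to `A + B`; this is associativity.

Dilations along different directions commute because both composites give the fourth vertex of one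
parallelogram (`commute_of_not_parallel`). For `f`, `g` both along `OI`, take a translation `s` in
another direction: `g` commutes with `s` and with `s ∘ f`, whose direction is again not that of
`OI`, and therefore with `f`. This is commutativity. -/

namespace DesarguesAffinePlane

/-! ### Dilations of the plane along a fixed direction -/

/-- Collinear points are mapped to collinear points on a parallel line. -/
def IsDilation {P : Type*} (L : Type*) [Membership P L] (f : P → P) : Prop :=
  ∀ (X Y : P) (l m : L), X ∈ l → Y ∈ l → f X ∈ m → LineParallel P l m → f Y ∈ m

/-- Every point is moved in the direction of the line `d`. -/
def IsAlong {P L : Type*} [Membership P L] (d : L) (f : P → P) : Prop :=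
  ∀ (X : P) (m : L), X ∈ m → LineParallel P d m → f X ∈ m

section

variable {P L : Type*} [Membership P L] {f g : P → P} {d e : L}

theorem IsAlong.comp (hf : IsAlong d f) (hg : IsAlong d g) : IsAlong d (f ∘ g) :=
  fun X m hX hm => hf _ m (hg X m hX hm) hm

theorem isDilation_id : IsDilation L (id : P → P) := fun X Y l m hX hY hm hp => by
  rw [← parallel_eq hp hX hm]
  exact hY

theorem isAlong_id : IsAlong d (id : P → P) := fun _ _ hX _ => hX

/-- The line joining a point to its image is invariant. -/
theorem IsDilation.mem_of_trace (hf : IsDilation L f) {X Y : P} {l : L} (hX : X ∈ l)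
    (hfX : f X ∈ l) (hY : Y ∈ l) : f Y ∈ l :=
  hf X Y l l hX hY hfX (parallel_refl l)

variable [DesarguesAffinePlane P L]

theorem IsDilation.comp (hf : IsDilation L f) (hg : IsDilation L g) :
    IsDilation L (f ∘ g) := fun X Y l _ hX hY hm hp =>
  hf (g X) (g Y) (parallelThrough (g X) l) _ (mem_parallelThrough _ _)
    (hg X Y l _ hX hY (mem_parallelThrough _ _) (parallel_parallelThrough _ _)) hm
    (parallel_trans (parallel_symm (parallel_parallelThrough _ _)) hp)

theorem meet_unique {X Y : P} {l m : L} (hlm : ¬ LineParallel P l m) (h1 : X ∈ l) (h2 : X ∈ m)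
    (h3 : Y ∈ l) (h4 : Y ∈ m) : X = Y := by
  by_contra hne
  exact hlm (Or.inl (line_eq hne h1 h3 h2 h4))

/-- Two dilations along `d` that agree at a point agree at every point off its parallel to `d`. -/
theorem eq_of_notMem (hf : IsDilation L f) (hg : IsDilation L g) (hfd : IsAlong d f)
    (hgd : IsAlong d g) {X Y : P} (hX : f X = g X) (hY : Y ∉ parallelThrough X d) :
    f Y = g Y := by
  have hXY : X ≠ Y := fun e => hY (e ▸ mem_parallelThrough X d)
  have hp := parallel_parallelThrough (f X) (join L hXY)
  have hq := parallel_parallelThrough Y d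
  have hnp : ¬ LineParallel P (parallelThrough (f X) (join L hXY)) (parallelThrough Y d) := by
    intro hc
    refine hY ?_
    rw [parallelThrough_eq (left_mem_join hXY)
      (parallel_symm (parallel_trans hp (parallel_trans hc (parallel_symm hq))))]
    exact right_mem_join _
  -- The image of `Y` is forced: it lies on the parallel to `XY` through `f X` and on the parallel
  -- to `d` through `Y`.
  exact meet_unique hnp
    (hf X Y _ _ (left_mem_join hXY) (right_mem_join _) (mem_parallelThrough _ _) hp)
    (hfd Y _ (mem_parallelThrough _ _) hq)
    (hg X Y _ _ (left_mem_join hXY) (right_mem_join _) (hX ▸ mem_parallelThrough _ _) hp)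
    (hgd Y _ (mem_parallelThrough _ _) hq)

/-- `eq_of_notMem` covers the points off the parallel to `d` through `X`. A point on that parallel
is reached through some `Z` off it, where `f` and `g` already agree. -/
theorem eq_of_agree (hf : IsDilation L f) (hg : IsDilation L g) (hfd : IsAlong d f)
    (hgd : IsAlong d g) {X : P} (hX : f X = g X) : f = g := by
  funext Y
  by_cases hY : Y ∈ parallelThrough X d
  · obtain ⟨Z, hZ⟩ := exists_notMem P (parallelThrough X d)
    have hq := parallel_parallelThrough Z d
    refine eq_of_notMem hf hg hfd hgd (eq_of_notMem hf hg hfd hgd hX hZ) fun hYZ => hZ ?_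
    rw [parallel_eq (parallel_trans (parallel_symm (parallel_parallelThrough X d)) hq) hY hYZ]
    exact mem_parallelThrough _ _
  · exact eq_of_notMem hf hg hfd hgd hX hY

theorem eq_id_of_fixed (hf : IsDilation L f) (hfd : IsAlong d f) {X : P} (hX : f X = X) :
    f = id :=
  eq_of_agree hf isDilation_id hfd isAlong_id hX

/-- Dilations along different directions commute. -/
theorem commute_of_not_parallel (hf : IsDilation L f) (hg : IsDilation L g) (hfd : IsAlong d f)
    (hge : IsAlong e g) (hde : ¬ LineParallel P d e) (X : P) : f (g X) = g (f X) := by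
  have hd := parallel_parallelThrough (g X) d
  have he := parallel_parallelThrough (f X) e
  have hd' := parallel_parallelThrough X d
  have he' := parallel_parallelThrough X e
  -- Both composites send `X` to the fourth vertex of the parallelogram on `X`, `f X`, `g X`: the
  -- meet of the parallel to `d` through `g X` with the parallel to `e` through `f X`.
  refine meet_unique
    (fun hc => hde (parallel_trans hd (parallel_trans hc (parallel_symm he))))
    (hfd (g X) _ (mem_parallelThrough _ _) hd)
    (hf X (g X) _ _ (mem_parallelThrough X e) (hge X _ (mem_parallelThrough _ _) he')
      (mem_parallelThrough _ _) (parallel_trans (parallel_symm he') he))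
    (hg X (f X) _ _ (mem_parallelThrough X d) (hfd X _ (mem_parallelThrough _ _) hd')
      (mem_parallelThrough _ _) (parallel_trans (parallel_symm hd') hd))
    (hge (f X) _ (mem_parallelThrough _ _) he)

/-- A dilation without fixed points has parallel traces. -/
theorem IsDilation.isAlong (hf : IsDilation L f) (hfix : ∀ X, f X ≠ X) {X : P} (hX : X ∈ d)
    (hfX : f X ∈ d) : IsAlong d f := by
  intro Y m hY hm
  set t := join L (hfix Y) with ht
  have h1 : f Y ∈ t := left_mem_join _
  have h2 : Y ∈ t := right_mem_join _
  have hp : LineParallel P d t := by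
    -- A point `V` common to two non-parallel traces is fixed, since `f V` lies on both of them.
    by_contra hc
    obtain ⟨V, hV, hV'⟩ := exists_meet hc
    exact hfix V (meet_unique hc (hf.mem_of_trace hX hfX hV) (hf.mem_of_trace h2 h1 hV') hV hV')
  rw [← parallel_eq (parallel_trans (parallel_symm hp) hm) h2 hY]
  exact h1

end

end DesarguesAffinePlane

/-! ### Addition on the line `OI` as a translation of the plane -/

namespace CoordLine

open DesarguesAffinePlane

variable {P L : Type*} [Membership P L] [DesarguesAffinePlane P L] {O I : P} {h : O ≠ I}

/-- A point of the line `OI`. -/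
def ofMem {X : P} (hX : X ∈ join L h) : CoordLine L h := ⟨X, hX⟩

/-- Independence of the auxiliary point lets any point off `OI` serve as `B₁`; in
`exists_translation` it is the point being moved. -/
theorem add_eq_iff_via {A B S : CoordLine L h} {B₁ : P} (hB₁ : B₁ ∉ join L h) :
    A + B = S ↔ IsSumVia hB₁ A B S :=
  ⟨fun e => by
    obtain ⟨B₂, hB₂, H⟩ := add_eq_iff.1 e
    exact isSumVia_indep hB₂ hB₁ H, fun H => add_eq_iff.2 ⟨B₁, hB₁, H⟩⟩

theorem zero_add' (A : CoordLine L h) : 0 + A = A := by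
  obtain ⟨B₁, hB₁⟩ := exists_notMem P (join L h)
  exact (add_eq_iff_via hB₁).2 (isSumVia_zero_left A hB₁)

theorem add_zero' (A : CoordLine L h) : A + 0 = A := by
  obtain ⟨B₁, hB₁⟩ := exists_notMem P (join L h)
  exact (add_eq_iff_via hB₁).2 (isSumVia_zero_right A hB₁)

theorem mul_zero' (A : CoordLine L h) : A * 0 = 0 := by
  obtain ⟨B₁, hB₁⟩ := exists_notMem P (join L h)
  exact mul_eq_iff.2 ⟨B₁, hB₁, isProdVia_zero_right A hB₁⟩

theorem sub_self' (A : CoordLine L h) : A - A = 0 :=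
  (existsUnique_add_eq_zero A).choose_spec.1

/-- Parallelograms over the same side `OA` give parallel lines. -/
theorem parallel_of_sum_step {A : CoordLine L h} (hA : A ≠ 0) {X Y X' Y' : P} {l m : L}
    (hX : X ∉ join L h) (hY : Y ∉ join L h)
    (hX₁ : X' ∈ parallelThrough X (join L h))
    (hX₂ : X' ∈ parallelThrough A.1 (join L (ne_of_notMem (0 : CoordLine L h) hX)))
    (hY₁ : Y' ∈ parallelThrough Y (join L h))
    (hY₂ : Y' ∈ parallelThrough A.1 (join L (ne_of_notMem (0 : CoordLine L h) hY)))
    (hne : parallelThrough X (join L h) ≠ parallelThrough Y (join L h))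
    (hXl : X ∈ l) (hYl : Y ∈ l) (hXm : X' ∈ m) (hYm : Y' ∈ m) : LineParallel P l m := by
  have hOA : O ≠ A.1 := fun e => hA (Subtype.ext e.symm)
  have hp {Z : P} := parallel_parallelThrough Z (join L h)
  have hoff {Z Z' : P} (hZ : Z ∉ join L h) (hZ' : Z' ∈ parallelThrough Z (join L h)) :
      Z' ∉ join L h := notMem_of_parallel hp (mem_parallelThrough _ _) hZ hZ'
  have hj {Z : P} (hZ : Z ∉ join L h) :
      join L (ne_of_notMem (0 : CoordLine L h) hZ) ≠
        parallelThrough A.1 (join L (ne_of_notMem (0 : CoordLine L h) hZ)) := fun e => by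
    have hAm := mem_parallelThrough A.1 (join L (ne_of_notMem (0 : CoordLine L h) hZ))
    rw [← e] at hAm
    exact hZ (line_eq hOA (left_mem_join (ne_of_notMem (0 : CoordLine L h) hZ)) hAm
      (left_mem_join h) A.2 ▸ right_mem_join _)
  have hmove {Z Z' : P} (hZ : Z ∉ join L h)
      (hZ' : Z' ∈ parallelThrough A.1 (join L (ne_of_notMem (0 : CoordLine L h) hZ))) :
      Z ≠ Z' := by
    rintro rfl
    exact hj hZ (parallel_eq (parallel_parallelThrough _ _) (right_mem_join _) hZ')
  have hpar : LineParallel P (parallelThrough X (join L h)) (parallelThrough Y (join L h)) :=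
    parallel_trans (parallel_symm hp) hp
  have hdist {Z W : P} (hZ : Z ∈ parallelThrough X (join L h))
      (hW : W ∈ parallelThrough Y (join L h)) : Z ≠ W := by
    rintro rfl
    exact hne (parallel_eq hpar hZ hW)
  -- Desargues for the triangles `X O Y` and `X' A Y'`, whose corresponding vertices lie on three
  -- distinct parallels, the middle one being `OI`.
  exact desargues X O Y X' A.1 Y' (parallelThrough X (join L h)) (join L h)
    (parallelThrough Y (join L h)) (join L (ne_of_notMem (0 : CoordLine L h) hX))
    (join L (ne_of_notMem (0 : CoordLine L h) hY)) l
    (parallelThrough A.1 (join L (ne_of_notMem (0 : CoordLine L h) hX)))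
    (parallelThrough A.1 (join L (ne_of_notMem (0 : CoordLine L h) hY))) m
    (hmove hX hX₂) hOA (hmove hY hY₂) (ne_of_notMem (0 : CoordLine L h) hX).symm
    (ne_of_notMem (0 : CoordLine L h) hY)
    (hdist (mem_parallelThrough _ _) (mem_parallelThrough _ _))
    (ne_of_notMem A (hoff hX hX₁)).symm (ne_of_notMem A (hoff hY hY₁)) (hdist hX₁ hY₁)
    (mem_parallelThrough _ _) hX₁ (left_mem_join h) A.2 (mem_parallelThrough _ _) hY₁
    (fun e => hX (e ▸ mem_parallelThrough _ _)) (fun e => hY (e ▸ mem_parallelThrough _ _)) hne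
    (Or.inl ⟨parallel_symm hp, hp⟩)
    (right_mem_join _) (left_mem_join _) (left_mem_join _) (right_mem_join _) hXl hYl
    hX₂ (mem_parallelThrough _ _) (mem_parallelThrough _ _) hY₂ hXm hYm
    (hj hX) (hj hY) (parallel_parallelThrough _ _) (parallel_parallelThrough _ _)

/-- Addition of `A` extends to a translation of the whole plane. -/
theorem exists_translation (A : CoordLine L h) :
    ∃ f : P → P, IsDilation L f ∧ IsAlong (join L h) f ∧
      ∀ X : CoordLine L h, f X.1 = (A + X).1 := by
  by_cases hA : A = 0
  · subst hA
    exact ⟨id, isDilation_id, isAlong_id, fun X => by rw [zero_add']; rfl⟩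
  -- On `OI` the map is `X ↦ A + X`. Off `OI` it sends `X` to the point `P₁` of the addition
  -- algorithm with auxiliary point `X`, the fourth vertex of the parallelogram on `O`, `A`, `X`.
  have hex : ∀ X : P, ∃ X' : P, (∀ hX : X ∈ join L h, X' = (A + (ofMem hX)).1) ∧
      ∀ hX : X ∉ join L h, X' ∈ parallelThrough X (join L h) ∧
        X' ∈ parallelThrough A.1 (join L (ne_of_notMem (0 : CoordLine L h) hX)) := by
    intro X
    by_cases hX : X ∈ join L h
    · exact ⟨(A + ofMem hX).1, fun _ => rfl, fun hc => absurd hX hc⟩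
    · obtain ⟨X', hX', -⟩ := sum_step A hX
      exact ⟨X', fun hc => absurd hc hX, fun _ => hX'⟩
  choose f hon hoff using hex
  have hmem : ∀ X ∈ join L h, f X ∈ join L h := fun X hX => by
    rw [hon X hX]
    exact (A + (ofMem hX)).2
  have halong : IsAlong (join L h) f := by
    intro X m hX hm
    by_cases hX' : X ∈ join L h
    · rw [← parallel_eq hm hX' hX]
      exact hmem X hX'
    · rw [← parallelThrough_eq hX hm]
      exact (hoff X hX').1
  -- The last step of the algorithm for `A + X` with auxiliary point `Y` says exactly that the image
  -- of the line `XY` is parallel to it.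
  have hmixed : ∀ (X Y : P) (hX : X ∈ join L h) (hY : Y ∉ join L h),
      f X ∈ parallelThrough (f Y) (join L (ne_of_notMem (ofMem hX) hY)) := by
    intro X Y hX hY
    obtain ⟨P₁, h1, h2, h3⟩ :=
      (add_eq_iff_via hY).1 (rfl : A + (ofMem hX) = _)
    rw [hon X hX, (sum_step A hY).unique (hoff Y hY) ⟨h1, h2⟩]
    exact h3
  refine ⟨f, fun X Y l m hX hY hm hp => ?_, halong, fun X => hon X.1 X.2⟩
  by_cases hXY : X = Y
  · exact hXY ▸ hm
  -- Lines parallel to `OI` are invariant. On any other line two distinct points lie on different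
  -- parallels to `OI`, as `parallel_of_sum_step` requires.
  by_cases hlp : LineParallel P (join L h) l
  · have e := parallel_eq hp (halong X l hX hlp) hm
    exact e ▸ halong Y l hY hlp
  by_cases hX' : X ∈ join L h <;> by_cases hY' : Y ∈ join L h
  · exact absurd (Or.inl (line_eq hXY hX' hY' hX hY)) hlp
  · have h1 := hmixed X Y hX' hY'
    have e : join L (ne_of_notMem (ofMem hX') hY') = l :=
      line_eq hXY (left_mem_join _) (right_mem_join _) hX hY
    rw [e] at h1
    rw [parallel_eq (parallel_trans (parallel_symm hp) (parallel_parallelThrough (f Y) l)) hm h1]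
    exact mem_parallelThrough _ _
  · have h1 := hmixed Y X hY' hX'
    have e : join L (ne_of_notMem (ofMem hY') hX') = l :=
      line_eq hXY (right_mem_join _) (left_mem_join _) hX hY
    rwa [e, parallelThrough_eq hm hp] at h1
  · have hne : parallelThrough X (join L h) ≠ parallelThrough Y (join L h) := by
      intro e
      have hYX : Y ∈ parallelThrough X (join L h) := e ▸ mem_parallelThrough _ _
      exact hlp (line_eq hXY (mem_parallelThrough _ _) hYX hX hY ▸
        parallel_parallelThrough X (join L h))
    have hff : f X ≠ f Y := fun e => hne (parallel_eq
      (parallel_trans (parallel_symm (parallel_parallelThrough _ _))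
        (parallel_parallelThrough _ _)) (hoff X hX').1 (e ▸ (hoff Y hY').1))
    have h1 := parallel_of_sum_step hA hX' hY' (hoff X hX').1 (hoff X hX').2 (hoff Y hY').1
      (hoff Y hY').2 hne hX hY (left_mem_join (L := L) hff) (right_mem_join hff)
    rw [parallel_eq (parallel_trans (parallel_symm hp) h1) hm (left_mem_join _)]
    exact right_mem_join _

/-! ### Associativity and commutativity of addition -/

theorem translation_zero {A : CoordLine L h} {f : P → P}
    (hf : ∀ X : CoordLine L h, f X.1 = (A + X).1) : f O = A.1 := by
  rw [← congrArg Subtype.val (add_zero' A)]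
  exact hf 0

/-- The translation of `A + B` and the composite of those of `A` and `B` agree at `O`, so they are
equal; evaluation at `C` gives the law. -/
theorem add_assoc' (A B C : CoordLine L h) : (A + B) + C = A + (B + C) := by
  obtain ⟨f, hf, hfd, hfA⟩ := exists_translation A
  obtain ⟨g, hg, hgd, hgB⟩ := exists_translation B
  obtain ⟨k, hk, hkd, hkS⟩ := exists_translation (A + B)
  have e : k = f ∘ g := by
    refine eq_of_agree hk (hf.comp hg) hkd (hfd.comp hgd) (X := O) ?_
    rw [translation_zero hkS, Function.comp_apply, translation_zero hgB, hfA]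
  apply Subtype.ext
  rw [← hkS, e, Function.comp_apply, hgB, hfA]

/-- The translations of `A` and `B` share a direction, so `commute_of_not_parallel` does not apply
to them directly. It applies to `g` paired with `s` and with `s ∘ f`, where `s` is a translation
along a line `OQ` different from `OI`. -/
theorem add_comm' (A B : CoordLine L h) : A + B = B + A := by
  by_cases hA : A = 0
  · rw [hA, zero_add', add_zero']
  obtain ⟨f, hf, hfd, hfA⟩ := exists_translation A
  obtain ⟨g, hg, hgd, hgB⟩ := exists_translation B
  obtain ⟨Q, hQ⟩ := exists_notMem P (join L h)
  have hOQ : O ≠ Q := ne_of_notMem (0 : CoordLine L h) hQ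
  -- `OQ` is taken as a coordinate line with unit `Q`, so its translation by `1` carries `O` to `Q`.
  obtain ⟨s, hs, hsd, hsQ⟩ := exists_translation (1 : CoordLine L hOQ)
  have hsO : s O = Q := translation_zero hsQ
  have hnp : ∀ {Z : P} (hZ : O ≠ Z), Z ∉ join L h → ¬ LineParallel P (join L h) (join L hZ) :=
    fun hZ hZ' => not_parallel_of (left_mem_join h) (left_mem_join hZ)
      fun e => hZ' (e ▸ right_mem_join _)
  have hfs := commute_of_not_parallel hf hs hfd hsd (hnp hOQ hQ)
  have hgs := commute_of_not_parallel hg hs hgd hsd (hnp hOQ hQ)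
  -- If `s` brings `f X` back to `X`, then `X` and `f X` lie on a common parallel to `OI` and on a
  -- common parallel to `OQ`. So `f` fixes `X`, hence `f = id` and `A = O`.
  have hfix : ∀ X, (s ∘ f) X ≠ X := by
    intro X hX
    have hd := parallel_parallelThrough X (join L h)
    have he := parallel_parallelThrough (f X) (join L hOQ)
    have hX' : X ∈ parallelThrough (f X) (join L hOQ) := by
      have := hsd (f X) _ (mem_parallelThrough _ _) he
      rwa [show s (f X) = X from hX] at this
    have hfX : f X = X := meet_unique
      (fun hc => hnp hOQ hQ (parallel_trans hd (parallel_trans hc (parallel_symm he))))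
      (hfd X _ (mem_parallelThrough _ _) hd) (mem_parallelThrough _ _)
      (mem_parallelThrough _ _) hX'
    have hid := eq_id_of_fixed hf hfd hfX
    exact hA (Subtype.ext (by rw [← translation_zero hfA, hid]; rfl))
  -- This point equals `f Q`, which lies on the parallel to `OI` through `Q`. Hence the direction of
  -- `s ∘ f` is not that of `OI`.
  have hR : (s ∘ f) O ∉ join L h := by
    have hp := parallel_parallelThrough Q (join L h)
    refine notMem_of_parallel hp (mem_parallelThrough _ _) hQ ?_
    rw [Function.comp_apply, ← hfs, hsO]
    exact hfd Q _ (mem_parallelThrough _ _) hp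
  have hOR : O ≠ (s ∘ f) O := ne_of_notMem (0 : CoordLine L h) hR
  have hsf := (hs.comp hf).isAlong hfix (left_mem_join (L := L) hOR) (right_mem_join hOR)
  have hgsf := commute_of_not_parallel hg (hs.comp hf) hgd hsf (hnp hOR hR) O
  have hfg : f ∘ g = g ∘ f := by
    -- Comparing at `s O` instead of `O` avoids cancelling `s`, whose injectivity is not
    -- established.
    refine eq_of_agree (hf.comp hg) (hg.comp hf) (hfd.comp hgd) (hgd.comp hfd) (X := s O) ?_
    simp only [Function.comp_apply] at hgsf ⊢
    rw [hgs, hfs, hfs, hgsf]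
  have := congrFun hfg O
  simp only [Function.comp_apply] at this
  rw [translation_zero hgB, translation_zero hfA, hfA, hgB] at this
  exact Subtype.ext this

/-! ### Möbius points -/

theorem mobius_self (B C D : CoordLine L h) : mobius B C D C = 0 := by
  -- `C - C` is the right factor of the second bracket, and that bracket is the right factor of the
  -- whole product; the inverses need not be computed.
  rw [mobius, crossRatio, sub_self', mul_zero', mul_zero']

end CoordLine

theorem theorem2p1 {P L : Type*} [Membership P L] [DesarguesAffinePlane P L]
    {O I : P} (h : O ≠ I) (B C D : CoordLine L h)
    (hBC : B ≠ C) (hBD : B ≠ D) (hCD : C ≠ D) (hB : B ≠ 0) (hC : C ≠ 0) (hD : D ≠ 0) :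
    (∀ X Y Z : CoordLine L h, X ≠ D → Y ≠ D → Z ≠ D →
      (CoordLine.mobius B C D X + CoordLine.mobius B C D Y) + CoordLine.mobius B C D Z =
        CoordLine.mobius B C D X + (CoordLine.mobius B C D Y + CoordLine.mobius B C D Z)) ∧
    (∀ X Y : CoordLine L h, X ≠ D → Y ≠ D →
      CoordLine.mobius B C D X + CoordLine.mobius B C D Y =
        CoordLine.mobius B C D Y + CoordLine.mobius B C D X) ∧
    CoordLine.mobius B C D C = 0 ∧
    (∀ X : CoordLine L h, X ≠ D →
      CoordLine.mobius B C D X + CoordLine.mobius B C D C = CoordLine.mobius B C D X ∧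
      CoordLine.mobius B C D C + CoordLine.mobius B C D X = CoordLine.mobius B C D X) := by
  refine ⟨fun _ _ _ _ _ _ => CoordLine.add_assoc' _ _ _, fun _ _ _ _ => CoordLine.add_comm' _ _,
    CoordLine.mobius_self B C D, fun X _ => ?_⟩
  rw [CoordLine.mobius_self]
  exact ⟨CoordLine.add_zero' _, CoordLine.zero_add' _⟩
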